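/- Let $G$ be a graph on $n\ge 1$ vertices with edge weights $v_{ij}\ge 0$, let $d\ge 1$ be an integer (the deadline), and let the vertices arrive one per period in a uniformly random order, i.e. vertex $i$ arrives at time $\sigma(i)$, where $\sigma$ is a uniformly random permutation of $\{1,\dots,n\}$. The online graph $G_{d,\sigma}$ consists of the edges $(i,j)$ of $G$ with $|\sigma(i)-\sigma(j)|\le d$, and $\mathrm{OFF}(\sigma)$ is the maximum weight of a matching of $G_{d,\sigma}$. The batching algorithm partitions the arrivals into consecutive batches of $d+1$ vertices (the last batch may be smaller); at the end of each batch it selects a maximum-weight matching of the subgraph of $G$ induced by the batch (ties broken arbitrarily) and discards the vertices left unmatched. Let $\mathrm{BAT}(\sigma)$ be the total weight of the edges it selects. Then batching is $(0.279+O(1/n))$-competitive for every fixed $d$, with an error term $O(d/n)$ uniform in $d$: there is an absolute constant $C$ such that, for all $d\ge 1$, all $n\ge 1$ and every such weighted graph $G$, $$\mathbb{E}_\sigma[\mathrm{BAT}(\sigma)]\;\ge\;\Bigl(0.279-\frac{C\,(d+1)}{n}\Bigr)\,\mathbb{E}_\sigma[\mathrm{OFF}(\sigma)].$$ -/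

import Mathlib

open scoped BigOperators

noncomputable section

namespace DynamicMatching

open Classical in
/-- Total weight of the edges of a subgraph (used for matchings). -/
def matchingWeight {n : ℕ} {H : SimpleGraph (Fin n)} (w : Sym2 (Fin n) → ℝ)
    (M : H.Subgraph) : ℝ :=
  ∑ e : Sym2 (Fin n) with e ∈ M.edgeSet, w e

/-- `M` is a maximum-weight matching of `H`. -/
def IsMaxWeightMatching {n : ℕ} {H : SimpleGraph (Fin n)} (w : Sym2 (Fin n) → ℝ)
    (M : H.Subgraph) : Prop :=
  M.IsMatching ∧ ∀ M' : H.Subgraph, M'.IsMatching → matchingWeight w M' ≤ matchingWeight w M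

/-- The value of a maximum-weight matching of `H`. The set is finite, and nonempty because of
the empty matching, so the supremum is attained. -/
def maxMatchingWeight {n : ℕ} (H : SimpleGraph (Fin n)) (w : Sym2 (Fin n) → ℝ) : ℝ :=
  sSup {x : ℝ | ∃ M : H.Subgraph, M.IsMatching ∧ matchingWeight w M = x}

/-- The online graph with deadline `d`: vertex `i` arrives at time `σ i` (times are
`0, …, n - 1`), and an edge of `G` survives iff its endpoints arrive at most `d` periods apart. -/
def onlineGraph {n : ℕ} (G : SimpleGraph (Fin n)) (d : ℕ) (σ : Equiv.Perm (Fin n)) :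
    SimpleGraph (Fin n) where
  Adj i j := G.Adj i j ∧ |((σ i : ℕ) : ℤ) - ((σ j : ℕ) : ℤ)| ≤ (d : ℤ)
  symm := ⟨fun _ _ h => ⟨h.1.symm, by rw [abs_sub_comm]; exact h.2⟩⟩
  loopless := ⟨fun i h => G.loopless.irrefl i h.1⟩

/-- The `b`-th batch (`b = 0, 1, …`): the vertices arriving at the times
`(d + 1) * b, …, (d + 1) * b + d`. -/
def batch {n : ℕ} (d : ℕ) (σ : Equiv.Perm (Fin n)) (b : ℕ) : Set (Fin n) :=
  {i | (σ i : ℕ) / (d + 1) = b}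

/-- The edges of `G` with both endpoints in the `b`-th batch. -/
def batchGraph {n : ℕ} (G : SimpleGraph (Fin n)) (d : ℕ) (σ : Equiv.Perm (Fin n)) (b : ℕ) :
    SimpleGraph (Fin n) where
  Adj i j := G.Adj i j ∧ i ∈ batch d σ b ∧ j ∈ batch d σ b
  symm := ⟨fun _ _ h => ⟨h.1.symm, h.2.2, h.2.1⟩⟩
  loopless := ⟨fun i h => G.loopless.irrefl i h.1⟩

/-- The number `⌈n / (d + 1)⌉` of batches; the last one may have fewer than `d + 1` vertices. -/
def numBatches (n d : ℕ) : ℕ := (n + d) / (d + 1)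

/-- A run of the batching algorithm under the arrival order `σ`: in each batch, a maximum-weight
matching (ties broken arbitrarily) of the vertices of that batch alone is selected;
the vertices of the batch that it leaves unmatched are discarded. -/
def IsBatchingRun {n : ℕ} (G : SimpleGraph (Fin n)) (w : Sym2 (Fin n) → ℝ) (d : ℕ)
    (σ : Equiv.Perm (Fin n)) (M : ∀ b : ℕ, (batchGraph G d σ b).Subgraph) : Prop :=
  ∀ b : ℕ, IsMaxWeightMatching w (M b)

/-- The total weight collected in a run of the batching algorithm. -/
def batchingReward {n : ℕ} {G : SimpleGraph (Fin n)} (w : Sym2 (Fin n) → ℝ) {d : ℕ}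
    {σ : Equiv.Perm (Fin n)} (M : ∀ b : ℕ, (batchGraph G d σ b).Subgraph) : ℝ :=
  ∑ b ∈ Finset.range (numBatches n d), matchingWeight w (M b)

/-- Batching has a run for every arrival order. -/
theorem exists_isBatchingRun {n : ℕ} (G : SimpleGraph (Fin n)) (w : Sym2 (Fin n) → ℝ) (d : ℕ)
    (σ : Equiv.Perm (Fin n)) :
    ∃ M : ∀ b : ℕ, (batchGraph G d σ b).Subgraph, IsBatchingRun G w d σ M := by
  have key : ∀ H : SimpleGraph (Fin n), ∃ M : H.Subgraph, IsMaxWeightMatching w M := by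
    intro H
    obtain ⟨M, hM, hmax⟩ := Set.exists_max_image {M : H.Subgraph | M.IsMatching}
      (matchingWeight w) (Set.toFinite _)
      ⟨⊥, fun v hv => absurd hv (Set.notMem_empty v)⟩
    exact ⟨M, hM, fun M' h => hmax M' h⟩
  choose M hM using fun b => key (batchGraph G d σ b)
  exact ⟨M, hM⟩

end DynamicMatching

end

open scoped BigOperators

noncomputable section

namespace DynamicMatching

open Finset

/-! ### Matchings of vertices arriving in a given set of positions -/

section Matchings

variable {n : ℕ}

/-! Write `m = d + 1`. Under a uniform order, the expected optimal matching weight among the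
vertices arriving at a set of positions depends only on the size of the set
(`sum_maxMatchingWeight_eq_of_card_eq`). So a full batch is worth as much as any cyclic shift of any
`m`-element set `S`. Fix an optimal online matching. An edge whose endpoints arrive `k ≤ d` apart
lies inside at least `differenceCount S k` of the `n` shifts, so averaging over shifts bounds the
batch value below by `min_k differenceCount S k / n` times the offline value
(`sum_maxMatchingWeight_cyclicShift_ge`).

It remains to find `S` representing every difference `1, …, d` often. Two suitable intervals give
about `m / 3` representations; `m = 4` needs an average over two sets (`exists_differenceCount_ge`).
Summing over the full batches loses only `O(m / n)`. -/

/-- The edges of `G` whose endpoints both arrive at times in `A`. -/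
def positionGraph (G : SimpleGraph (Fin n)) (σ : Equiv.Perm (Fin n)) (A : Finset (Fin n)) :
    SimpleGraph (Fin n) where
  Adj i j := G.Adj i j ∧ σ i ∈ A ∧ σ j ∈ A
  symm := ⟨fun _ _ h => ⟨h.1.symm, h.2.2, h.2.1⟩⟩
  loopless := ⟨fun i h => G.loopless.irrefl i h.1⟩

lemma bddAbove_matchingWeights (H : SimpleGraph (Fin n)) (w : Sym2 (Fin n) → ℝ) :
    BddAbove {x : ℝ | ∃ M : H.Subgraph, M.IsMatching ∧ matchingWeight w M = x} := by
  have : {x : ℝ | ∃ M : H.Subgraph, M.IsMatching ∧ matchingWeight w M = x} =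
      matchingWeight w '' {M : H.Subgraph | M.IsMatching} := by
    ext x; simp
  rw [this]
  exact (Set.toFinite _).bddAbove

lemma isMatching_bot (H : SimpleGraph (Fin n)) : (⊥ : H.Subgraph).IsMatching :=
  fun v hv => absurd hv (Set.notMem_empty v)

lemma matchingWeight_le_maxMatchingWeight {H : SimpleGraph (Fin n)} (w : Sym2 (Fin n) → ℝ)
    {M : H.Subgraph} (hM : M.IsMatching) : matchingWeight w M ≤ maxMatchingWeight H w :=
  le_csSup (bddAbove_matchingWeights H w) ⟨M, hM, rfl⟩

lemma maxMatchingWeight_nonneg (H : SimpleGraph (Fin n)) (w : Sym2 (Fin n) → ℝ) :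
    0 ≤ maxMatchingWeight H w := by
  refine le_trans (le_of_eq ?_) (matchingWeight_le_maxMatchingWeight w (isMatching_bot H))
  simp [matchingWeight]

lemma maxMatchingWeight_le {H : SimpleGraph (Fin n)} {w : Sym2 (Fin n) → ℝ} {c : ℝ}
    (h : ∀ M : H.Subgraph, M.IsMatching → matchingWeight w M ≤ c) : maxMatchingWeight H w ≤ c := by
  refine csSup_le ⟨_, ⊥, isMatching_bot H, rfl⟩ ?_
  rintro x ⟨M, hM, rfl⟩
  exact h M hM

lemma IsMaxWeightMatching.maxMatchingWeight_le {H : SimpleGraph (Fin n)}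
    {w : Sym2 (Fin n) → ℝ} {M : H.Subgraph} (hM : IsMaxWeightMatching w M) :
    maxMatchingWeight H w ≤ matchingWeight w M :=
  DynamicMatching.maxMatchingWeight_le hM.2

/-- The edges of a subgraph of an online graph whose endpoints both arrive at times in `A`. -/
def restrictToPositions {G : SimpleGraph (Fin n)} {d : ℕ} {σ : Equiv.Perm (Fin n)}
    (M : (onlineGraph G d σ).Subgraph) (A : Finset (Fin n)) :
    (positionGraph G σ A).Subgraph where
  verts := {v | ∃ v', M.Adj v v' ∧ σ v ∈ A ∧ σ v' ∈ A}
  Adj v v' := M.Adj v v' ∧ σ v ∈ A ∧ σ v' ∈ A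
  adj_sub h := ⟨h.1.adj_sub.1, h.2⟩
  edge_vert h := ⟨_, h⟩
  symm := ⟨fun _ _ h => ⟨h.1.symm, h.2.2, h.2.1⟩⟩

lemma isMatching_restrictToPositions {G : SimpleGraph (Fin n)} {d : ℕ} {σ : Equiv.Perm (Fin n)}
    {M : (onlineGraph G d σ).Subgraph} (hM : M.IsMatching) (A : Finset (Fin n)) :
    (restrictToPositions M A).IsMatching := by
  rintro v ⟨v', h⟩
  refine ⟨v', h, fun u hu => ?_⟩
  exact (hM (M.edge_vert h.1)).unique hu.1 h.1

open Classical in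
lemma sum_inside_le_maxMatchingWeight {G : SimpleGraph (Fin n)} {d : ℕ} {σ : Equiv.Perm (Fin n)}
    (w : Sym2 (Fin n) → ℝ) {M : (onlineGraph G d σ).Subgraph} (hM : M.IsMatching)
    (A : Finset (Fin n)) :
    ∑ e : Sym2 (Fin n) with e ∈ M.edgeSet, (if ∀ v ∈ e, σ v ∈ A then w e else 0) ≤
      maxMatchingWeight (positionGraph G σ A) w := by
  refine le_trans (le_of_eq ?_)
    (matchingWeight_le_maxMatchingWeight w (isMatching_restrictToPositions hM A))
  rw [matchingWeight, ← Finset.sum_filter, Finset.filter_filter]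
  congr 1
  ext e
  induction e with
  | h a b =>
    have : s(a, b) ∈ (restrictToPositions M A).edgeSet ↔ M.Adj a b ∧ σ a ∈ A ∧ σ b ∈ A := Iff.rfl
    simp [this]

lemma positionGraph_mul_map (G : SimpleGraph (Fin n)) (σ π : Equiv.Perm (Fin n))
    (A : Finset (Fin n)) :
    positionGraph G (π * σ) (A.map π.toEmbedding) = positionGraph G σ A := by
  ext i j
  simp [positionGraph]

/-- The total weight over all arrival orders that is collected from the positions in `A` depends
only on the number of positions. -/
lemma sum_maxMatchingWeight_eq_of_card_eq (G : SimpleGraph (Fin n)) (w : Sym2 (Fin n) → ℝ)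
    {A B : Finset (Fin n)} (h : A.card = B.card) :
    ∑ σ, maxMatchingWeight (positionGraph G σ A) w =
      ∑ σ, maxMatchingWeight (positionGraph G σ B) w := by
  obtain ⟨π, hπ⟩ : ∃ π : Equiv.Perm (Fin n), A.map π.toEmbedding = B := by
    let e : {x // x ∈ A} ≃ {x // x ∈ B} := Finset.equivOfCardEq h
    refine ⟨e.extendSubtype, Finset.eq_of_subset_of_card_le ?_ (by simp [h])⟩
    intro x hx
    obtain ⟨y, hy, rfl⟩ := Finset.mem_map.1 hx
    exact e.extendSubtype_mem y hy
  subst hπ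
  rw [← Equiv.sum_comp (Equiv.mulLeft π)
    (fun σ => maxMatchingWeight (positionGraph G σ (A.map π.toEmbedding)) w)]
  simp [positionGraph_mul_map]

end Matchings

/-! ### Cyclic shifts -/

section Shifts

open scoped Fin.CommRing

variable {n : ℕ}

/-- The cyclic shift by `u` of a set `S` of positions. -/
def cyclicShift (S : Finset ℕ) (u : Fin n) : Finset (Fin n) :=
  {p | ((p - u : Fin n) : ℕ) ∈ S}

lemma mem_cyclicShift {S : Finset ℕ} {u p : Fin n} :
    p ∈ cyclicShift S u ↔ ((p - u : Fin n) : ℕ) ∈ S := by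
  simp [cyclicShift]

variable [NeZero n]

lemma card_cyclicShift {S : Finset ℕ} (hS : ∀ x ∈ S, x < n) (u : Fin n) :
    (cyclicShift S u).card = S.card := by
  refine Finset.card_bij (fun p _ => ((p - u : Fin n) : ℕ)) (fun p hp => mem_cyclicShift.1 hp)
    (fun p _ q _ h => sub_left_injective (Fin.val_injective h)) (fun x hx => ?_)
  have hx' : ((x : Fin n) : ℕ) = x := Fin.val_cast_of_lt (hS x hx)
  exact ⟨(x : Fin n) + u, by simpa [mem_cyclicShift, hx'] using hx, by simpa using hx'⟩

/-- The number of pairs of elements of `S` with difference `k`. -/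
def differenceCount (S : Finset ℕ) (k : ℕ) : ℕ := #{x ∈ S | x + k ∈ S}

/-- Each pair `x, x + k` of `S` is carried onto `p, q` by the shift `p - x`, and distinct `x < n`
give distinct shifts. Wrap-around can only add shifts. -/
lemma differenceCount_le_card_shifts {S : Finset ℕ} (hS : ∀ x ∈ S, x < n) {p q : Fin n} {k : ℕ}
    (h : (p : ℕ) + k = q) :
    differenceCount S k ≤ #{u : Fin n | p ∈ cyclicShift S u ∧ q ∈ cyclicShift S u} := by
  have hq : q = p + (k : Fin n) := by
    rw [← Fin.cast_val_eq_self p, ← Fin.cast_val_eq_self q, ← h]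
    push_cast
    rfl
  refine Finset.card_le_card_of_injOn (fun x => p - (x : Fin n)) ?_ ?_
  · intro x hx
    obtain ⟨hx1, hx2⟩ := Finset.mem_filter.1 hx
    have e1 : ((x : Fin n) : ℕ) = x := Fin.val_cast_of_lt (hS x hx1)
    have e2 : (((x + k : ℕ) : Fin n) : ℕ) = x + k := Fin.val_cast_of_lt (hS _ hx2)
    have e3 : q - (p - (x : Fin n)) = ((x + k : ℕ) : Fin n) := by
      rw [hq]; push_cast; abel
    simp only [coe_filter, mem_univ, true_and, Set.mem_ofPred_eq, mem_cyclicShift, e3, e2,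
      sub_sub_cancel, e1]
    exact ⟨hx1, hx2⟩
  · intro x hx y hy hxy
    have hx1 := hS x (Finset.mem_filter.1 hx).1
    have hy1 := hS y (Finset.mem_filter.1 hy).1
    have : (x : Fin n) = (y : Fin n) := sub_right_injective hxy
    rw [← Fin.val_cast_of_lt hx1, ← Fin.val_cast_of_lt hy1, this]

/-- A double count of the edges of a maximum-weight matching of the online graph that are covered
by the cyclic shifts of `S`. -/
lemma sum_maxMatchingWeight_cyclicShift_ge (G : SimpleGraph (Fin n)) {w : Sym2 (Fin n) → ℝ}
    (hw : ∀ e ∈ G.edgeSet, 0 ≤ w e) (d : ℕ) (σ : Equiv.Perm (Fin n)) {S T : Finset ℕ}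
    (hS : ∀ x ∈ S, x < n) (hT : ∀ x ∈ T, x < n) {c : ℝ}
    (hc : ∀ k, 1 ≤ k → k ≤ d → c ≤ (differenceCount S k : ℝ) + differenceCount T k) :
    c * maxMatchingWeight (onlineGraph G d σ) w ≤
      ∑ u : Fin n, (maxMatchingWeight (positionGraph G σ (cyclicShift S u)) w +
        maxMatchingWeight (positionGraph G σ (cyclicShift T u)) w) := by
  classical
  obtain ⟨M, hM, hmax⟩ : ∃ M : (onlineGraph G d σ).Subgraph, IsMaxWeightMatching w M := by
    obtain ⟨M, hM, hmax⟩ := Set.exists_max_image {M : (onlineGraph G d σ).Subgraph | M.IsMatching}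
      (matchingWeight w) (Set.toFinite _) ⟨⊥, isMatching_bot _⟩
    exact ⟨M, hM, fun M' h => hmax M' h⟩
  have heq : maxMatchingWeight (onlineGraph G d σ) w = matchingWeight w M :=
    le_antisymm (maxMatchingWeight_le hmax) (matchingWeight_le_maxMatchingWeight w hM)
  have hcount : ∀ R : Finset ℕ,
      ∑ e : Sym2 (Fin n) with e ∈ M.edgeSet,
        (#{u : Fin n | ∀ v ∈ e, σ v ∈ cyclicShift R u} : ℝ) * w e ≤
      ∑ u : Fin n, maxMatchingWeight (positionGraph G σ (cyclicShift R u)) w := by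
    intro R
    refine le_trans (le_of_eq ?_)
      (Finset.sum_le_sum fun u _ => sum_inside_le_maxMatchingWeight w hM (cyclicShift R u))
    rw [Finset.sum_comm]
    refine Finset.sum_congr rfl fun e _ => ?_
    rw [← Finset.sum_filter, Finset.sum_const, nsmul_eq_mul]
  rw [Finset.sum_add_distrib]
  refine le_trans ?_ (add_le_add (hcount S) (hcount T))
  rw [heq, matchingWeight, Finset.mul_sum, ← Finset.sum_add_distrib]
  refine Finset.sum_le_sum fun e he => ?_
  rw [← add_mul]
  have heM : e ∈ M.edgeSet := (Finset.mem_filter.1 he).2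
  have heG : e ∈ (onlineGraph G d σ).edgeSet := M.edgeSet_subset heM
  clear he heM
  have main : ∀ a b : Fin n, (onlineGraph G d σ).Adj a b → σ a < σ b →
      c ≤ (#{u : Fin n | ∀ v ∈ s(a, b), σ v ∈ cyclicShift S u} : ℝ) +
        #{u : Fin n | ∀ v ∈ s(a, b), σ v ∈ cyclicShift T u} := by
    intro a b hab hlt
    have hlt' : ((σ a : Fin n) : ℕ) < (σ b : Fin n) := hlt
    have hd := hab.2
    rw [abs_le] at hd
    have hk : ((σ a : Fin n) : ℕ) + ((σ b : ℕ) - (σ a : ℕ)) = (σ b : ℕ) := by omega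
    refine (hc ((σ b : ℕ) - (σ a : ℕ)) (by omega) (by omega)).trans (add_le_add ?_ ?_)
    · simpa using differenceCount_le_card_shifts hS hk
    · simpa using differenceCount_le_card_shifts hT hk
  induction e with
  | h a b =>
    rw [SimpleGraph.mem_edgeSet] at heG
    refine mul_le_mul_of_nonneg_right ?_ (hw _ heG.1)
    rcases lt_trichotomy (σ a) (σ b) with h | h | h
    · exact main a b heG h
    · exact absurd (σ.injective h) heG.ne
    · rw [Sym2.eq_swap]
      exact main b a heG.symm h

end Shifts

/-! ### Sets in which every small difference occurs often -/

lemma card_le_differenceCount {S I : Finset ℕ} {k : ℕ} (h : ∀ x ∈ I, x ∈ S ∧ x + k ∈ S) :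
    I.card ≤ differenceCount S k :=
  Finset.card_le_card fun x hx => Finset.mem_filter.2 (h x hx)

/-- Two intervals, of `b` and `a` elements, the second one starting at `c`. -/
def twoIntervals (b c a : ℕ) : Finset ℕ := Finset.range b ∪ Finset.Ico c (c + a)

lemma mem_twoIntervals {b c a x : ℕ} : x ∈ twoIntervals b c a ↔ x < b ∨ c ≤ x ∧ x < c + a := by
  simp [twoIntervals]

lemma card_twoIntervals {b c a : ℕ} (h : b ≤ c) : (twoIntervals b c a).card = b + a := by
  rw [twoIntervals, Finset.card_union_of_disjoint]
  · simp
  · rw [Finset.disjoint_left]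
    intro x hx hx'
    simp at hx hx'
    omega

/-- Each difference up to the start of the second interval occurs at least `a` times, provided
that the gap between the two intervals is small enough. -/
lemma le_differenceCount_twoIntervals {b c a k : ℕ} (hbc : b ≤ c) (hcb : c + a ≤ 2 * b)
    (hk : k ≤ c) : a ≤ differenceCount (twoIntervals b c a) k := by
  -- For small `k`, the points `0, …, a - 1` stay in the first interval. Otherwise, count the points
  -- that stay in it together with those that jump from it into the second.
  rcases le_total (k + a) b with h | h
  · calc a = (Finset.range a).card := by simp
      _ ≤ _ := card_le_differenceCount fun x hx => by
        simp only [mem_twoIntervals, Finset.mem_range] at hx ⊢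
        omega
  · have hm : c - k ≤ min b (c + a - k) := by omega
    calc a ≤ (b - k) + (min b (c + a - k) - (c - k)) := by omega
      _ = (twoIntervals (b - k) (c - k) (min b (c + a - k) - (c - k))).card :=
        (card_twoIntervals (by omega)).symm
      _ ≤ _ := card_le_differenceCount fun x hx => by
        simp only [mem_twoIntervals] at hx ⊢
        omega

/-- There are two sets of `m` integers in which each of the differences `1, …, m - 1` occurs at
least `0.279 * m` times on average. -/
lemma exists_differenceCount_ge {m : ℕ} (hm : 2 ≤ m) :
    ∃ S T : Finset ℕ, S.card = m ∧ T.card = m ∧ (∀ x ∈ S, x < 2 * m) ∧ (∀ x ∈ T, x < 2 * m) ∧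
      ∀ k, 1 ≤ k → k ≤ m - 1 →
        2 * (0.279 * (m : ℝ)) ≤ (differenceCount S k : ℝ) + differenceCount T k := by
  -- Only here does `(m + 1) / 3` fall below `0.279 * m`; the next worst ratio is `2 / 7`, at `m =
  -- 7`.
  by_cases h4 : m = 4
  · subst h4
    refine ⟨{0, 1, 2, 3}, {0, 1, 3, 4}, rfl, rfl, by decide, by decide, fun k hk1 hk2 => ?_⟩
    have h3 : 3 ≤ differenceCount {0, 1, 2, 3} k + differenceCount {0, 1, 3, 4} k := by
      have hk3 : k ≤ 3 := hk2
      interval_cases k <;> decide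
    have h3' : (3 : ℝ) ≤ (differenceCount {0, 1, 2, 3} k : ℝ) + differenceCount {0, 1, 3, 4} k := by
      exact_mod_cast h3
    norm_num
    linarith
  -- With total size `m` and second interval starting at `m - 1`, the gap condition reads `3 * a ≤ m
  -- + 1`; `a` is taken as large as possible.
  · have hS : (twoIntervals (m - (m + 1) / 3) (m - 1) ((m + 1) / 3)).card = m := by
      rw [card_twoIntervals (by omega)]
      omega
    have hlt : ∀ x ∈ twoIntervals (m - (m + 1) / 3) (m - 1) ((m + 1) / 3), x < 2 * m := by
      intro x hx
      rw [mem_twoIntervals] at hx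
      omega
    refine ⟨_, _, hS, hS, hlt, hlt, fun k hk1 hk2 => ?_⟩
    have h1 : (m + 1) / 3 ≤
        differenceCount (twoIntervals (m - (m + 1) / 3) (m - 1) ((m + 1) / 3)) k :=
      le_differenceCount_twoIntervals (by omega) (by omega) hk2
    have h2 : 279 * m ≤ 1000 * ((m + 1) / 3) := by omega
    have h1' : (((m + 1) / 3 : ℕ) : ℝ) ≤
        differenceCount (twoIntervals (m - (m + 1) / 3) (m - 1) ((m + 1) / 3)) k := by
      exact_mod_cast h1
    have h2' : (279 : ℝ) * m ≤ 1000 * ((m + 1) / 3 : ℕ) := by exact_mod_cast h2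
    linarith

/-! ### Batches -/

section Batches

variable {n : ℕ}

/-- The positions of the `b`-th batch. -/
def batchPositions (n d b : ℕ) : Finset (Fin n) := {p | (p : ℕ) / (d + 1) = b}

lemma positionGraph_batchPositions (G : SimpleGraph (Fin n)) (d : ℕ) (σ : Equiv.Perm (Fin n))
    (b : ℕ) : positionGraph G σ (batchPositions n d b) = batchGraph G d σ b := by
  ext i j
  simp [positionGraph, batchGraph, batchPositions, batch]

lemma card_batchPositions {d b : ℕ} (hb : b < n / (d + 1)) :
    (batchPositions n d b).card = d + 1 := by
  have hle : (d + 1) * (b + 1) ≤ n :=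
    (Nat.mul_le_mul_left _ hb).trans (Nat.mul_div_le n (d + 1))
  rw [mul_add, mul_one] at hle
  have hmem : ∀ x : ℕ, x / (d + 1) = b ↔ (d + 1) * b ≤ x ∧ x < (d + 1) * b + (d + 1) := by
    intro x
    rw [Nat.div_eq_iff (by omega), mul_comm b]
    omega
  have himage : (batchPositions n d b).map Fin.valEmbedding =
      Finset.Ico ((d + 1) * b) ((d + 1) * b + (d + 1)) := by
    ext x
    simp only [batchPositions, Finset.mem_map, Finset.mem_filter, Finset.mem_univ, true_and,
      Fin.valEmbedding_apply, Finset.mem_Ico, ← hmem]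
    constructor
    · rintro ⟨p, hp, rfl⟩
      exact hp
    · intro hx
      exact ⟨⟨x, ((hmem x).1 hx).2.trans_le hle⟩, hx, rfl⟩
  rw [← Finset.card_map Fin.valEmbedding, himage]
  simp

/-- Lower bound on the total weight over all arrival orders that a full batch collects. -/
lemma sum_maxMatchingWeight_batchGraph_ge {d b : ℕ} (hd : 1 ≤ d) (hb : b < n / (d + 1))
    (hn : 2 * (d + 1) ≤ n) (G : SimpleGraph (Fin n)) {w : Sym2 (Fin n) → ℝ}
    (hw : ∀ e ∈ G.edgeSet, 0 ≤ w e) :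
    0.279 * ((d : ℝ) + 1) * ∑ σ, maxMatchingWeight (onlineGraph G d σ) w ≤
      n * ∑ σ, maxMatchingWeight (batchGraph G d σ b) w := by
  have : NeZero n := ⟨by omega⟩
  obtain ⟨S, T, hSc, hTc, hS, hT, hcount⟩ := exists_differenceCount_ge (m := d + 1) (by omega)
  replace hS : ∀ x ∈ S, x < n := fun x hx => (hS x hx).trans_le hn
  replace hT : ∀ x ∈ T, x < n := fun x hx => (hT x hx).trans_le hn
  have hsum := Finset.sum_le_sum fun σ (_ : σ ∈ (Finset.univ : Finset (Equiv.Perm (Fin n)))) =>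
    sum_maxMatchingWeight_cyclicShift_ge G hw d σ hS hT hcount
  have hshift : ∀ R : Finset ℕ, (∀ x ∈ R, x < n) → R.card = d + 1 → ∀ u : Fin n,
      ∑ σ, maxMatchingWeight (positionGraph G σ (cyclicShift R u)) w =
        ∑ σ, maxMatchingWeight (batchGraph G d σ b) w := by
    intro R hR hRc u
    rw [sum_maxMatchingWeight_eq_of_card_eq G w (B := batchPositions n d b)
      (by rw [card_cyclicShift hR, hRc, card_batchPositions hb])]
    simp only [positionGraph_batchPositions]
  rw [← Finset.mul_sum, Finset.sum_comm] at hsum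
  simp only [Finset.sum_add_distrib, hshift S hS hSc, hshift T hT hTc, Finset.sum_const,
    Finset.card_univ, Fintype.card_fin, nsmul_eq_mul] at hsum
  push_cast at hsum
  linarith

lemma sum_batchingReward_ge {d : ℕ} (hd : 1 ≤ d) (hn : 2 * (d + 1) ≤ n)
    (G : SimpleGraph (Fin n)) {w : Sym2 (Fin n) → ℝ} (hw : ∀ e ∈ G.edgeSet, 0 ≤ w e)
    {M : ∀ (σ : Equiv.Perm (Fin n)) (b : ℕ), (batchGraph G d σ b).Subgraph}
    (hM : ∀ σ, IsBatchingRun G w d σ (M σ)) :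
    (0.279 - ((d : ℝ) + 1) / n) * ∑ σ, maxMatchingWeight (onlineGraph G d σ) w ≤
      ∑ σ, batchingReward w (M σ) := by
  set X := ∑ σ, maxMatchingWeight (onlineGraph G d σ) w
  have hX0 : 0 ≤ X := Finset.sum_nonneg fun σ _ => maxMatchingWeight_nonneg _ w
  have hn0 : (0 : ℝ) < n := by exact_mod_cast (by omega : 0 < n)
  have hfull : n / (d + 1) ≤ numBatches n d := Nat.div_le_div_right (Nat.le_add_right n d)
  have hreward : ∑ b ∈ Finset.range (n / (d + 1)),
      ∑ σ, maxMatchingWeight (batchGraph G d σ b) w ≤ ∑ σ, batchingReward w (M σ) := by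
    rw [Finset.sum_comm]
    refine Finset.sum_le_sum fun σ _ => ?_
    refine (Finset.sum_le_sum_of_subset_of_nonneg (Finset.range_mono hfull)
      fun b _ _ => maxMatchingWeight_nonneg _ w).trans ?_
    exact Finset.sum_le_sum fun b _ => (hM σ b).maxMatchingWeight_le
  have hbatch : ∀ b ∈ Finset.range (n / (d + 1)),
      0.279 * ((d : ℝ) + 1) * X / n ≤ ∑ σ, maxMatchingWeight (batchGraph G d σ b) w := by
    intro b hb
    rw [div_le_iff₀ hn0, mul_comm _ (n : ℝ)]
    exact sum_maxMatchingWeight_batchGraph_ge hd (Finset.mem_range.1 hb) hn G hw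
  have hcard := Finset.card_nsmul_le_sum _ _ _ hbatch
  rw [Finset.card_range, nsmul_eq_mul] at hcard
  refine le_trans ?_ (hcard.trans hreward)
  -- The partial last batch is dropped, costing less than `d + 1` positions.
  have hfloor : (n : ℝ) ≤ (d + 1) * ((n / (d + 1) : ℕ) : ℝ) + (d + 1) := by
    have := (Nat.lt_mul_div_succ n (Nat.succ_pos d)).le
    rw [mul_add, mul_one] at this
    exact_mod_cast this
  have hrw : ((n / (d + 1) : ℕ) : ℝ) * (0.279 * ((d : ℝ) + 1) * X / n) =
      0.279 * (((d : ℝ) + 1) * ((n / (d + 1) : ℕ) : ℝ) / n) * X := by ring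
  rw [hrw]
  refine mul_le_mul_of_nonneg_right ?_ hX0
  have h1 : 1 ≤ ((d : ℝ) + 1) * ((n / (d + 1) : ℕ) : ℝ) / n + ((d : ℝ) + 1) / n := by
    rw [← add_div, le_div_iff₀ hn0]
    linarith
  have h2 : 0 ≤ ((d : ℝ) + 1) / n := by positivity
  linarith

end Batches

end DynamicMatching

end

theorem mainTheorem2 :
    ∃ C : ℝ, ∀ (d n : ℕ), 1 ≤ d → 1 ≤ n →
      ∀ (G : SimpleGraph (Fin n)) (w : Sym2 (Fin n) → ℝ), (∀ e ∈ G.edgeSet, 0 ≤ w e) →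
      ∀ M : ∀ (σ : Equiv.Perm (Fin n)) (b : ℕ), (DynamicMatching.batchGraph G d σ b).Subgraph,
        (∀ σ : Equiv.Perm (Fin n), DynamicMatching.IsBatchingRun G w d σ (M σ)) →
        ((0.279 : ℝ) - C * ((d : ℝ) + 1) / (n : ℝ)) *
            (𝔼 σ : Equiv.Perm (Fin n),
              DynamicMatching.maxMatchingWeight (DynamicMatching.onlineGraph G d σ) w)
          ≤ 𝔼 σ : Equiv.Perm (Fin n), DynamicMatching.batchingReward w (M σ) := by
  refine ⟨1, fun d n hd hn G w hw M hM => ?_⟩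
  have hn0 : (0 : ℝ) < n := by exact_mod_cast hn
  rw [Finset.expect_eq_sum_div_card, Finset.expect_eq_sum_div_card, ← mul_div_assoc, one_mul]
  refine div_le_div_of_nonneg_right ?_ (Nat.cast_nonneg _)
  -- The sets need `2 * (d + 1)` positions. With fewer, the error term exceeds `1 / 2 > 0.279`, so
  -- the left side is nonpositive.
  rcases le_or_gt (2 * (d + 1)) n with h | h
  · exact DynamicMatching.sum_batchingReward_ge hd h G hw hM
  · have h1 : (1 : ℝ) / 2 ≤ ((d : ℝ) + 1) / n := by
      have : (n : ℝ) < 2 * (d + 1) := by exact_mod_cast h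
      rw [le_div_iff₀ hn0]
      linarith
    have h2 : 0 ≤ ∑ σ, DynamicMatching.batchingReward w (M σ) :=
      Finset.sum_nonneg fun σ _ => Finset.sum_nonneg fun b _ =>
        (DynamicMatching.maxMatchingWeight_nonneg _ w).trans (hM σ b).maxMatchingWeight_le
    refine le_trans (mul_nonpos_of_nonpos_of_nonneg (by linarith) ?_) h2
    exact Finset.sum_nonneg fun σ _ => DynamicMatching.maxMatchingWeight_nonneg _ w
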